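/- **Setting.** Let $k$ be a field of characteristic zero, let $Y=\operatorname{Spec}A$ be a smooth irreducible affine variety over $k$ with function field $K$, let $r\ge 1$, let $x_1,\dots,x_r\in A$ be regular parameters on $Y$, and let $w_1,\dots,w_r$ be positive integers. Here $x_1,\dots,x_r$ are called *regular parameters on $Y$* if $V(x_1,\dots,x_r)\subset Y$ is nonempty and, for every point $p\in V(x_1,\dots,x_r)$, the elements $x_1,\dots,x_r$ extend to a regular system of parameters of $\mathcal O_{Y,p}$. Let $\mathbf{ZR}(Y)$ be the Zariski–Riemann space of $Y$, whose points $v$ are the valuation rings $R_v$ of $K$ that contain $k$ and dominate $\mathcal O_{Y,p}$ for some point $p\in Y$; write $v:K^*\to\Gamma_v=K^*/R_v^*$ for the corresponding valuation, and put $v(0)=\infty$. A *valuative $\mathbb Q$-ideal* $\gamma$ on $Y$ is a nonnegative global section of the sheaf $\Gamma\otimes_{\mathbb Z}\mathbb Q$ on $\mathbf{ZR}(Y)$, where $\Gamma=K^*/\mathcal O^*$ and $\mathcal O$ is the sheaf of rings with stalks $R_v$; its germ at $v$ is $\gamma_v\in\Gamma_v\otimes_{\mathbb Z}\mathbb Q$.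 It determines, for every integer $m\ge 0$, the ideal $$I_{m\gamma}=\{f\in A \mid v(f)\ge m\gamma_v \text{ for all } v\in\mathbf{ZR}(Y)\}$$ and the graded $A$-algebra $A_\gamma=\bigoplus_{m\ge 0}I_{m\gamma}T^m\subset A[T]$. Let $\gamma=(x_1^{1/w_1},\dots,x_r^{1/w_r})$ be the valuative $\mathbb Q$-ideal with germs $\gamma_v=\min_{1\le i\le r}\tfrac1{w_i}v(x_i)$. **Proposition (Rees algebra generators).** For every integer $m\ge 0$, $$I_{m\gamma}=\Big(x_1^{b_1}\cdots x_r^{b_r}\ \Big|\ b_1,\dots,b_r\in\mathbb Z_{\ge 0},\ \sum_{i=1}^r w_ib_i\ge m\Big).$$ In particular, $A_\gamma$ is generated as an $A$-algebra by the elements $x_iT^j$ with $1\le i\le r$ and $1\le j\le w_i$. -/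

import Mathlib

open scoped Polynomial

noncomputable section

namespace WeightedBlowup

/-! ### Value groups -/

section ValueGroups

variable {K : Type*} [Field K]

/-- The value group `Γ_v = Kˣ / R_vˣ` of a valuation ring `R_v` of `K`, as an additive totally
ordered abelian group. Mathlib's `ValueGroup` is multiplicative, contains an extra zero, and is
ordered so that elements of the valuation ring have value `≤ 1`; hence `Additive`, the units, and
the order dual. -/
def ValGroup (R : ValuationSubring K) : Type _ := (Additive R.ValueGroupˣ)ᵒᵈ

instance (R : ValuationSubring K) : AddCommGroup (ValGroup R) :=
  inferInstanceAs (AddCommGroup (Additive R.ValueGroupˣ)ᵒᵈ)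

instance (R : ValuationSubring K) : LinearOrder (ValGroup R) :=
  inferInstanceAs (LinearOrder (Additive R.ValueGroupˣ)ᵒᵈ)

instance (R : ValuationSubring K) : IsOrderedAddMonoid (ValGroup R) :=
  inferInstanceAs (IsOrderedAddMonoid (Additive R.ValueGroupˣ)ᵒᵈ)

/-- The totally ordered abelian group `Γ_v ⊗ ℚ`. -/
abbrev QValGroup (R : ValuationSubring K) : Type _ := DivisibleHull (ValGroup R)

/-- The additive valuation `v : Kˣ → Γ_v`. -/
def unitVal (R : ValuationSubring K) : Additive Kˣ →+ ValGroup R :=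
  AddMonoidHom.mk' (fun g => OrderDual.toDual
    (Additive.ofMul (Units.map (R.valuation : K →* R.ValueGroup) g.toMul)))
    fun a b => by
      rw [toMul_add, map_mul, ofMul_mul, toDual_add]
      rfl

/-- The additive valuation `v : Kˣ → Γ_v → Γ_v ⊗ ℚ`. -/
def unitQVal (R : ValuationSubring K) : Additive Kˣ →+ QValGroup R :=
  (DivisibleHull.coeAddMonoidHom (ValGroup R)).comp (unitVal R)

open Classical in
/-- The additive valuation `v : K → (Γ_v ⊗ ℚ) ∪ {∞}`, with `v(0) = ∞`. -/
def qVal (R : ValuationSubring K) (x : K) : WithTop (QValGroup R) :=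
  if h : x = 0 then ⊤ else (unitQVal R (Additive.ofMul (Units.mk0 x h)) : QValGroup R)

variable (R : ValuationSubring K)

@[simp] theorem qVal_zero : qVal R 0 = ⊤ := by simp [qVal]

theorem qVal_of_ne_zero {x : K} (h : x ≠ 0) :
    qVal R x = (unitQVal R (Additive.ofMul (Units.mk0 x h)) : QValGroup R) := by
  simp [qVal, h]

theorem unitVal_le_iff (a b : Kˣ) :
    unitVal R (Additive.ofMul a) ≤ unitVal R (Additive.ofMul b) ↔
      R.valuation (b : K) ≤ R.valuation (a : K) := Iff.rfl

theorem unitQVal_le_iff (a b : Kˣ) :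
    unitQVal R (Additive.ofMul a) ≤ unitQVal R (Additive.ofMul b) ↔
      R.valuation (b : K) ≤ R.valuation (a : K) := by
  rw [← unitVal_le_iff]
  simp [unitQVal]

theorem qVal_le_iff (x y : K) : qVal R x ≤ qVal R y ↔ R.valuation y ≤ R.valuation x := by
  by_cases hx : x = 0
  · subst hx
    by_cases hy : y = 0
    · simp [hy]
    · rw [qVal_zero, qVal_of_ne_zero R hy]
      simp [hy]
  by_cases hy : y = 0
  · simp [hy]
  · rw [qVal_of_ne_zero R hx, qVal_of_ne_zero R hy, WithTop.coe_le_coe, unitQVal_le_iff]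
    simp

theorem qVal_one : qVal R 1 = 0 := by
  rw [qVal_of_ne_zero R one_ne_zero, Units.mk0_one, ofMul_one, map_zero, WithTop.coe_zero]

theorem qVal_nonneg_iff (x : K) : 0 ≤ qVal R x ↔ x ∈ R := by
  rw [← qVal_one R, qVal_le_iff, map_one, ValuationSubring.valuation_le_one_iff]

theorem qVal_mul (x y : K) : qVal R (x * y) = qVal R x + qVal R y := by
  by_cases hx : x = 0
  · simp [hx]
  by_cases hy : y = 0
  · simp [hy]
  rw [qVal_of_ne_zero R hx, qVal_of_ne_zero R hy, qVal_of_ne_zero R (mul_ne_zero hx hy),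
    ← WithTop.coe_add, ← map_add, ← ofMul_mul, ← Units.mk0_mul]

theorem le_qVal_add {c : WithTop (QValGroup R)} {x y : K} (hx : c ≤ qVal R x)
    (hy : c ≤ qVal R y) : c ≤ qVal R (x + y) := by
  rcases le_total (R.valuation x) (R.valuation y) with h | h
  · exact hy.trans ((qVal_le_iff R _ _).2 (R.valuation.map_add_le h le_rfl))
  · exact hx.trans ((qVal_le_iff R _ _).2 (R.valuation.map_add_le le_rfl h))

end ValueGroups

/-! ### The Zariski-Riemann space of `Y = Spec A` -/

section ZariskiRiemann

variable (k A : Type*) [Field k] [CommRing A] [IsDomain A] [Algebra k A]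

/-- The point `p` of `Y = Spec A` is a center of the valuation ring `R` of the function field:
the local ring `𝒪_{Y,p}` is contained in `R`, and its maximal ideal is its intersection with the
maximal ideal of `R` (that is, `R` dominates `𝒪_{Y,p}`). -/
def IsCenterOf {A : Type*} [CommRing A] [IsDomain A] (R : ValuationSubring (FractionRing A))
    (p : PrimeSpectrum A) : Prop :=
  ∀ a s : A, s ∉ p.asIdeal →
    algebraMap A (FractionRing A) a / algebraMap A (FractionRing A) s ∈ R ∧
    (R.valuation (algebraMap A (FractionRing A) a / algebraMap A (FractionRing A) s) < 1 ↔
      a ∈ p.asIdeal)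

/-- The Zariski-Riemann space of `Y = Spec A` over `k`: the valuation rings of the function field
of `Y` that contain `k` and possess a center on `Y`. -/
structure ZR where
  /-- the valuation ring -/
  ring : ValuationSubring (FractionRing A)
  base_mem : ∀ c : k, algebraMap k (FractionRing A) c ∈ ring
  exists_center : ∃ p : PrimeSpectrum A, IsCenterOf ring p

variable {k A}

/-- The Zariski topology, with subbasic open sets `{v | x ∈ R_v}` for `x` in the function field. -/
instance : TopologicalSpace (ZR k A) :=
  TopologicalSpace.generateFrom
    {U | ∃ x : FractionRing A, U = {v : ZR k A | x ∈ v.ring}}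

theorem isOpen_setOf_mem (x : FractionRing A) : IsOpen {v : ZR k A | x ∈ v.ring} :=
  TopologicalSpace.isOpen_generateFrom_of_mem ⟨x, rfl⟩

theorem ZR.algebraMap_mem (v : ZR k A) (a : A) : algebraMap A (FractionRing A) a ∈ v.ring := by
  obtain ⟨p, hp⟩ := v.exists_center
  simpa using (hp a 1 ((Ideal.ne_top_iff_one _).1 p.isPrime.ne_top)).1

/-- The value `v(f) ∈ (Γ_v ⊗ ℚ) ∪ {∞}` of a regular function `f ∈ A` on `Y = Spec A`. -/
def ZR.val (v : ZR k A) (f : A) : WithTop (QValGroup v.ring) :=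
  qVal v.ring (algebraMap A (FractionRing A) f)

theorem ZR.val_nonneg (v : ZR k A) (f : A) : 0 ≤ v.val f :=
  (qVal_nonneg_iff _ _).2 (v.algebraMap_mem f)

theorem ZR.val_ne_top (v : ZR k A) {f : A} (hf : f ≠ 0) : v.val f ≠ ⊤ := by
  have h : algebraMap A (FractionRing A) f ≠ 0 := by simpa using hf
  rw [ZR.val, qVal_of_ne_zero _ h]
  exact WithTop.coe_ne_top

theorem ZR.val_mul (v : ZR k A) (f g : A) : v.val (f * g) = v.val f + v.val g := by
  rw [ZR.val, map_mul, qVal_mul, ← ZR.val, ← ZR.val]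

/-! ### Valuative `ℚ`-ideals -/

variable (k A) in
/-- A valuative `ℚ`-ideal on `Y = Spec A`: a nonnegative global section of the sheaf `Γ ⊗ ℚ` on
the Zariski-Riemann space, where `Γ = Kˣ / 𝒪ˣ`. It is given by its germs `γ_v ∈ Γ_v ⊗ ℚ`, which
are required to be nonnegative and to come, locally on the Zariski-Riemann space, from elements
`g ⊗ q` with `g ∈ Kˣ` and `q ∈ ℚ`. -/
@[ext] structure ValuativeQIdeal where
  /-- the germ `γ_v` -/
  germ : ∀ v : ZR k A, QValGroup v.ring
  germ_nonneg : ∀ v, 0 ≤ germ v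
  exists_local : ∀ v : ZR k A, ∃ U : Set (ZR k A), IsOpen U ∧ v ∈ U ∧
    ∃ (g : (FractionRing A)ˣ) (q : ℚ), ∀ w ∈ U,
      germ w = q • unitQVal w.ring (Additive.ofMul g)

/-- The multiple `m γ` of a valuative `ℚ`-ideal, for a natural number `m`. -/
instance : SMul ℕ (ValuativeQIdeal k A) where
  smul m γ :=
    { germ := fun v => m • γ.germ v
      germ_nonneg := fun v => nsmul_nonneg (γ.germ_nonneg v) m
      exists_local := fun v => by
        obtain ⟨U, hU, hv, g, q, h⟩ := γ.exists_local v
        refine ⟨U, hU, hv, g, (m : ℚ) * q, fun w hw => ?_⟩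
        rw [h w hw, mul_smul, Nat.cast_smul_eq_nsmul] }

@[simp] theorem ValuativeQIdeal.smul_germ (m : ℕ) (γ : ValuativeQIdeal k A) (v : ZR k A) :
    (m • γ).germ v = m • γ.germ v := rfl

/-- The ideal `I_γ = {f ∈ A | v(f) ≥ γ_v for all v}` of global sections of the ideal sheaf
determined by the valuative `ℚ`-ideal `γ`. -/
def ValuativeQIdeal.ideal (γ : ValuativeQIdeal k A) : Ideal A where
  carrier := {f | ∀ v : ZR k A, (γ.germ v : WithTop (QValGroup v.ring)) ≤ v.val f}
  zero_mem' v := by simp [ZR.val]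
  add_mem' {f g} hf hg v := by
    rw [ZR.val, map_add]
    exact le_qVal_add _ (hf v) (hg v)
  smul_mem' c f hf v := by
    rw [smul_eq_mul, ZR.val_mul]
    exact (hf v).trans (le_add_of_nonneg_left (v.val_nonneg c))

theorem ValuativeQIdeal.mem_ideal (γ : ValuativeQIdeal k A) (f : A) :
    f ∈ γ.ideal ↔ ∀ v : ZR k A, (γ.germ v : WithTop (QValGroup v.ring)) ≤ v.val f := Iff.rfl

/-- The graded `A`-subalgebra `A_γ = ⨁_{m ≥ 0} I_{mγ} Tᵐ` of `A[T]`. -/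
def ValuativeQIdeal.reesAlgebra (γ : ValuativeQIdeal k A) : Subalgebra A A[X] where
  carrier := {p | ∀ m : ℕ, p.coeff m ∈ (m • γ).ideal}
  add_mem' {p q} hp hq m := by
    rw [Polynomial.coeff_add]
    exact Ideal.add_mem _ (hp m) (hq m)
  mul_mem' {p q} hp hq m := by
    rw [Polynomial.coeff_mul]
    refine Ideal.sum_mem _ fun ij hij v => ?_
    rw [← Finset.HasAntidiagonal.mem_antidiagonal.1 hij, ZR.val_mul, smul_germ, add_smul, WithTop.coe_add]
    exact add_le_add (hp ij.1 v) (hq ij.2 v)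
  algebraMap_mem' a m := by
    rw [Polynomial.algebraMap_apply, Algebra.algebraMap_self, RingHom.id_apply,
      Polynomial.coeff_C]
    split_ifs with h
    · subst h
      intro v
      rw [smul_germ, zero_smul]
      exact v.val_nonneg a
    · exact Ideal.zero_mem _

theorem ValuativeQIdeal.mem_reesAlgebra (γ : ValuativeQIdeal k A) (p : A[X]) :
    p ∈ γ.reesAlgebra ↔ ∀ m : ℕ, p.coeff m ∈ (m • γ).ideal := Iff.rfl

/-! ### The valuative `ℚ`-ideal `(f₁^{a₁}, …, f_r^{a_r})` -/

section OfFunctions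

variable {ι : Type*} [Fintype ι]

/-- The minimum of the `aᵢ · v(fᵢ)`, in `(Γ_v ⊗ ℚ) ∪ {∞}`. -/
def minVal (v : ZR k A) (f : ι → A) (a : ι → ℚ) : WithTop (QValGroup v.ring) :=
  Finset.univ.inf fun i => (v.val (f i)).map fun x => a i • x

theorem minVal_ne_top (v : ZR k A) (f : ι → A) (a : ι → ℚ) (hf : ∃ i, f i ≠ 0) :
    minVal v f a ≠ ⊤ := by
  obtain ⟨i, hi⟩ := hf
  refine ne_top_of_le_ne_top ?_ (Finset.inf_le (Finset.mem_univ i))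
  rw [Ne, WithTop.map_eq_top_iff]
  exact v.val_ne_top hi

theorem ratSMul_le_iff (R : ValuationSubring (FractionRing A)) {a b : ℚ} (ha : 0 < a) (hb : 0 < b)
    (f g : (FractionRing A)ˣ) :
    b • unitQVal R (Additive.ofMul g) ≤ a • unitQVal R (Additive.ofMul f) ↔
      (f : FractionRing A) ^ (a.num.natAbs * b.den) / (g : FractionRing A) ^ (b.num.natAbs * a.den)
        ∈ R := by
  have hab : (0 : ℚ) < a.den * b.den := by
    have := a.den_pos; have := b.den_pos; positivity
  have key : ∀ (c d : ℚ), 0 < c → ∀ x : QValGroup R,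
      ((c.den : ℚ) * d.den) • (c • x) = (c.num.natAbs * d.den) • x := by
    intro c d hc x
    have h1 : (c.num.natAbs : ℚ) = c * c.den := by
      rw [Rat.mul_den_eq_num, ← Int.cast_natCast, Int.natAbs_of_nonneg (Rat.num_pos.2 hc).le]
    rw [smul_smul, ← Nat.cast_smul_eq_nsmul ℚ]
    congr 1
    push_cast
    rw [h1]
    ring
  rw [← smul_le_smul_iff_of_pos_left hab, key a b ha, mul_comm (a.den : ℚ), key b a hb,
    ← map_nsmul (unitQVal R), ← map_nsmul (unitQVal R), ← ofMul_pow, ← ofMul_pow, unitQVal_le_iff,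
    ← ValuationSubring.valuation_le_one_iff, map_div₀, div_le_one₀]
  · simp
  · exact zero_lt_iff.2 (by simp)

/-- The valuative `ℚ`-ideal `(f₁^{a₁}, …, f_r^{a_r})`, whose germ at `v` is `min {aᵢ · v(fᵢ)}`,
for regular functions `fᵢ ∈ A`, not all zero, and positive rational numbers `aᵢ`. -/
def ValuativeQIdeal.ofFunctions (f : ι → A) (a : ι → ℚ) (ha : ∀ i, 0 < a i) (hf : ∃ i, f i ≠ 0) :
    ValuativeQIdeal k A where
  germ v := (minVal v f a).untop (minVal_ne_top v f a hf)
  germ_nonneg v := by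
    rw [← WithTop.coe_le_coe, WithTop.coe_untop, minVal]
    refine Finset.le_inf fun i _ => ?_
    have h := v.val_nonneg (f i)
    generalize v.val (f i) = y at h
    cases y with
    | top => simp
    | coe y =>
      rw [WithTop.map_coe]
      exact WithTop.coe_le_coe.2 (smul_nonneg (ha i).le (WithTop.coe_le_coe.1 h))
  exists_local v := by
    classical
    have : Nonempty ι := ⟨hf.choose⟩
    obtain ⟨i, -, hi⟩ := Finset.exists_mem_eq_inf (Finset.univ : Finset ι) Finset.univ_nonempty
      fun i => (v.val (f i)).map fun x => a i • x
    have hi0 : f i ≠ 0 := by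
      intro h0
      refine minVal_ne_top v f a hf (hi.trans ?_)
      simp [h0, ZR.val]
    have hK : ∀ j, f j ≠ 0 → algebraMap A (FractionRing A) (f j) ≠ 0 := fun j hj => by
      simpa using hj
    let g : (FractionRing A)ˣ := Units.mk0 _ (hK i hi0)
    have hmap : ∀ (w : ZR k A) (j : ι) (hj : f j ≠ 0),
        (w.val (f j)).map (fun x => a j • x) =
          ((a j • unitQVal w.ring (Additive.ofMul (Units.mk0 _ (hK j hj))) :
            QValGroup w.ring) : WithTop (QValGroup w.ring)) := by
      intro w j hj
      rw [ZR.val, qVal_of_ne_zero _ (hK j hj), WithTop.map_coe]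
    refine ⟨⋂ j : ι, {w : ZR k A | algebraMap A (FractionRing A) (f j) ^
        ((a j).num.natAbs * (a i).den) / (g : FractionRing A) ^ ((a i).num.natAbs * (a j).den)
          ∈ w.ring}, isOpen_iInter_of_finite fun j => isOpen_setOf_mem _, ?_, g, a i, ?_⟩
    · refine Set.mem_iInter.2 fun j => ?_
      by_cases hj : f j = 0
      · have h1 : (a j).num.natAbs * (a i).den ≠ 0 :=
          mul_ne_zero (Int.natAbs_ne_zero.2 (Rat.num_ne_zero.2 (ha j).ne')) (a i).den_ne_zero
        simp only [Set.mem_ofPred_eq, hj, map_zero, zero_pow h1, zero_div]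
        exact v.ring.zero_mem
      · have h1 : (v.val (f i)).map (fun x => a i • x) ≤ (v.val (f j)).map fun x => a j • x := by
          rw [← hi]
          exact Finset.inf_le (Finset.mem_univ j)
        rw [hmap v i hi0, hmap v j hj, WithTop.coe_le_coe,
          ratSMul_le_iff _ (ha j) (ha i)] at h1
        exact h1
    · intro w hw
      rw [← WithTop.coe_inj, WithTop.coe_untop, minVal]
      refine le_antisymm ((Finset.inf_le (Finset.mem_univ i)).trans (hmap w i hi0).le) ?_
      refine Finset.le_inf fun j _ => ?_
      by_cases hj : f j = 0
      · simp [hj, ZR.val]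
      · rw [hmap w j hj, WithTop.coe_le_coe, ratSMul_le_iff _ (ha j) (ha i)]
        exact Set.mem_iInter.1 hw j

theorem ValuativeQIdeal.coe_ofFunctions_germ (f : ι → A) (a : ι → ℚ) (ha : ∀ i, 0 < a i)
    (hf : ∃ i, f i ≠ 0) (v : ZR k A) :
    (((ValuativeQIdeal.ofFunctions f a ha hf : ValuativeQIdeal k A).germ v : QValGroup v.ring) :
      WithTop (QValGroup v.ring)) =
      Finset.univ.inf fun i => (v.val (f i)).map fun x => a i • x :=
  WithTop.coe_untop _ _

end OfFunctions

end ZariskiRiemann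

/-! ### Regular parameters -/

/-- A regular system of parameters of a regular local ring: `dim R` elements that generate the
maximal ideal. -/
structure IsRegularSystemOfParameters (R : Type*) [CommRing R] [IsLocalRing R] {n : ℕ}
    (y : Fin n → R) : Prop where
  isRegularLocalRing : IsRegularLocalRing R
  ringKrullDim_eq : ringKrullDim R = n
  span_eq : Ideal.span (Set.range y) = IsLocalRing.maximalIdeal R

/-- `x₁, …, x_r ∈ A`, with `r ≥ 1`, are regular parameters on `Spec A`: the closed subscheme
`V(x₁, …, x_r)` is nonempty and, at each of its points `p`, they extend to a regular system of
parameters of the local ring `A_p`. -/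
structure IsRegularParameters {A : Type*} [CommRing A] {r : ℕ} (x : Fin r → A) : Prop where
  pos : 0 < r
  nonempty : (PrimeSpectrum.zeroLocus (Set.range x)).Nonempty
  extends_at : ∀ p ∈ PrimeSpectrum.zeroLocus (Set.range x),
    ∃ (n : ℕ) (y : Fin n → Localization.AtPrime p.asIdeal) (e : Fin r ↪ Fin n),
      IsRegularSystemOfParameters (Localization.AtPrime p.asIdeal) y ∧
        ∀ i, y (e i) = algebraMap A (Localization.AtPrime p.asIdeal) (x i)

theorem IsRegularSystemOfParameters.ne_zero {R : Type*} [CommRing R] [IsLocalRing R] {n : ℕ}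
    {y : Fin n → R} (hy : IsRegularSystemOfParameters R y) (i : Fin n) : y i ≠ 0 := by
  classical
  intro h0
  have := hy.isRegularLocalRing
  have h1 : Ideal.span ((Finset.univ.erase i).image y : Set R) = IsLocalRing.maximalIdeal R := by
    rw [← hy.span_eq]
    refine le_antisymm (Ideal.span_mono ?_) (Ideal.span_le.2 ?_)
    · intro z hz
      simp only [Finset.coe_image, Set.mem_image] at hz
      obtain ⟨j, -, rfl⟩ := hz
      exact ⟨j, rfl⟩
    · rintro _ ⟨j, rfl⟩
      by_cases hj : j = i
      · subst hj
        rw [h0]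
        exact Ideal.zero_mem _
      · exact Ideal.subset_span (by
          simp only [Finset.coe_image, Set.mem_image]
          exact ⟨j, by simp [hj], rfl⟩)
  have h2 : (IsLocalRing.maximalIdeal R).spanFinrank ≤ n - 1 := by
    rw [← h1]
    refine (Submodule.spanFinrank_span_le_ncard_of_finite (Finset.finite_toSet _)).trans ?_
    rw [Set.ncard_coe_finset]
    refine Finset.card_image_le.trans ?_
    rw [Finset.card_erase_of_mem (Finset.mem_univ i), Finset.card_univ, Fintype.card_fin]
  have h3 : (n : WithBot ℕ∞) ≤ ((n - 1 : ℕ) : WithBot ℕ∞) := by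
    rw [← hy.ringKrullDim_eq]
    exact (ringKrullDim_le_spanFinrank_maximalIdeal R).trans (by exact_mod_cast h2)
  have h4 : n ≤ n - 1 := by exact_mod_cast h3
  have := i.pos
  omega

theorem IsRegularParameters.ne_zero {A : Type*} [CommRing A] {r : ℕ} {x : Fin r → A}
    (hx : IsRegularParameters x) (i : Fin r) : x i ≠ 0 := by
  intro h0
  obtain ⟨p, hp⟩ := hx.nonempty
  obtain ⟨n, y, e, hy, he⟩ := hx.extends_at p hp
  exact hy.ne_zero (e i) (by rw [he i, h0, map_zero])

theorem IsRegularParameters.exists_ne_zero {A : Type*} [CommRing A] {r : ℕ} {x : Fin r → A}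
    (hx : IsRegularParameters x) : ∃ i, x i ≠ 0 :=
  ⟨⟨0, hx.pos⟩, hx.ne_zero _⟩

/-- The center `γ = (x₁^{1/w₁}, …, x_r^{1/w_r})` on `Y = Spec A` attached to regular parameters
`x₁, …, x_r` and positive integer weights `w₁, …, w_r`. -/
def weightedCenter (k : Type*) {A : Type*} [Field k] [CommRing A] [IsDomain A] [Algebra k A]
    {r : ℕ} (x : Fin r → A) (hx : IsRegularParameters x) (w : Fin r → ℕ) (hw : ∀ i, 0 < w i) :
    ValuativeQIdeal k A :=
  ValuativeQIdeal.ofFunctions x (fun i => 1 / (w i : ℚ))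
    (fun i => one_div_pos.2 (Nat.cast_pos.2 (hw i))) hx.exists_ne_zero

end WeightedBlowup

end

noncomputable section

namespace WeightedBlowup
open MvPolynomial IsLocalRing

/-! ### Quasi-regularity of a system of parameters. -/

section QuasiRegular

variable {R : Type*} [CommRing R] {σ : Type*}

/-! A monomial of weight at least `m` has value at least `mγ` at every `v`, so only the reverse
inclusion has content. It is local on `A`. At a maximal ideal missing some `xᵢ`, that `xᵢ` becomes a
unit and the monomial ideal contains the unit `xᵢ ^ m`. At a point of `V(x)`, the `xᵢ` extend to a
regular system of parameters `y` of the local ring `R`, and enough monomial valuations are available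
to test membership.

Those valuations come from positive weights `W` on `y`: filter `R` by the ideals generated by
monomials of `W`-weight at least `m`. Two elements of exact orders `d` and `e` are values at `y` of
polynomials whose reductions over the residue field have weighted orders `d` and `e`; weighted
orders add over a field. That the product has order exactly `d + e` then follows from weighted
quasi-regularity: a polynomial of weight at least `d` with value of order at least `d + 1` has its
weight-`d` coefficients in the maximal ideal
(`coeff_mem_maximalIdeal_of_eval_mem_weightedFiltration`). This reduces to ordinary
quasi-regularity, proved by Krull's height theorem over an infinite residue field. Hence the order
function is a valuation centered at the point (`exists_zr_val_le_iff_mem_weightedFiltration`).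

The natural weights are `wᵢ` on `xᵢ` and `0` elsewhere, but positivity is needed for a separated
filtration centered at the point. So take `1 + N wᵢ` on `xᵢ` and `1` on the other parameters.
Membership of `f` in `I_{mγ}` gives order at least `N m`, and a monomial of such order either has
`w`-weight at least `m` or has degree at least `N`. Thus `f` lies in the monomial ideal plus the
`N`-th power of the maximal ideal for every `N`, and Krull's intersection theorem concludes.

For the Rees algebra, a monomial of weight at least `m` times `T ^ m` splits into factors `xᵢ T ^ j`
with `j ≤ wᵢ`. -/

theorem eval_mul_of_isHomogeneous {F : MvPolynomial σ R} {e : ℕ} (hF : F.IsHomogeneous e)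
    (t : R) (a : σ → R) : eval (fun i => a i * t) F = eval a F * t ^ e := by
  rw [eval_eq, eval_eq, Finset.sum_mul]
  refine Finset.sum_congr rfl fun b hb => ?_
  have hb' : ∑ i ∈ b.support, b i = e := by
    have := hF (mem_support_iff.1 hb)
    rwa [Finsupp.weight_apply, Finsupp.sum, Finset.sum_congr rfl
      (fun i _ => by simp : ∀ i ∈ b.support, b i • (1 : σ → ℕ) i = b i)] at this
  simp_rw [mul_pow, Finset.prod_mul_distrib]
  rw [Finset.prod_pow_eq_pow_sum, hb', mul_assoc]

/-- In a local ring with infinite residue field, the vanishing of a form at `y` modulo the next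
power of the maximal ideal forces its coefficients to lie in the maximal ideal, if the length of
`y` is the dimension. -/
theorem coeff_mem_maximalIdeal_of_eval_mem_pow [IsLocalRing R] [IsNoetherianRing R]
    [Infinite (ResidueField R)] {n : ℕ} {y : Fin n → R}
    (hdim : ringKrullDim R = n) (hy : Ideal.span (Set.range y) = maximalIdeal R)
    {F : MvPolynomial (Fin n) R} {e : ℕ} (hF : F.IsHomogeneous e)
    (hFy : eval y F ∈ maximalIdeal R ^ (e + 1)) (b : Fin n →₀ ℕ) :
    coeff b F ∈ maximalIdeal R := by
  by_contra hb
  have hF0 : map (residue R) F ≠ 0 := by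
    intro h
    apply hb
    rw [← residue_eq_zero_iff, ← coeff_map, h, coeff_zero]
  -- Over an infinite field a nonzero polynomial has a point where it does not vanish.
  obtain ⟨a, ha⟩ : ∃ a, eval a (map (residue R) F) ≠ 0 := by
    by_contra! h
    exact hF0 (MvPolynomial.funext fun a => by simpa using h a)
  choose α hα using fun i => residue_surjective (a i)
  have hev : residue R (eval α F) = eval a (map (residue R) F) := by
    rw [eval_map, ← funext hα]
    exact eval₂_comp (residue R) α F
  have hunit : IsUnit (eval α F) := by
    rw [← residue_ne_zero_iff_isUnit, hev]
    exact ha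
  -- Otherwise `a = 0`, which forces `e = 0`; then `F` is constant, and its value is both a unit and
  -- in the maximal ideal.
  obtain ⟨j, hj⟩ : ∃ j, IsUnit (α j) := by
    by_contra! h
    have hα0 : ∀ i, α i ∈ maximalIdeal R := fun i => (mem_maximalIdeal _).2 (h i)
    have ha0 : a = fun i => a i * 0 := by
      ext i
      rw [mul_zero, ← hα i]
      exact (residue_eq_zero_iff _).2 (hα0 i)
    have hF' : (map (residue R) F).IsHomogeneous e := hF.map _
    rw [ha0, eval_mul_of_isHomogeneous hF'] at ha
    have he : e = 0 := by
      by_contra he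
      exact ha (by rw [zero_pow he, mul_zero])
    subst he
    have h1 := eval_mul_of_isHomogeneous hF 0 y
    have h2 := eval_mul_of_isHomogeneous hF 0 α
    simp only [mul_zero, pow_zero, mul_one] at h1 h2
    rw [← h2, h1] at hunit
    rw [zero_add, pow_one] at hFy
    exact hFy hunit
  obtain ⟨β, hβ⟩ := hj.exists_right_inv
  -- Restrict to the line through the origin in direction `α`: with `t = yⱼ / αⱼ`, one has `yᵢ ≡ αᵢ
  -- t` modulo the `n - 1` elements `uᵢ`, `i ≠ j`.
  obtain ⟨t, ht⟩ : ∃ t, t = y j * β := ⟨_, rfl⟩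
  set u : Fin n → R := fun i => y i - α i * t with hu
  have huj : u j = 0 := by
    rw [hu, ht]
    linear_combination (- y j) * hβ
  set U : Ideal R := Ideal.span (u '' {j}ᶜ) with hU
  have huU : ∀ i, u i ∈ U := fun i => by
    by_cases h : i = j
    · rw [h, huj]
      exact U.zero_mem
    · exact Ideal.subset_span ⟨i, h, rfl⟩
  let q := Ideal.Quotient.mk U
  have hqy : ∀ i, q (y i) = q (α i) * q t := fun i => by
    rw [← map_mul]
    exact Ideal.Quotient.eq.2 (huU i)
  have hym : ∀ i, y i ∈ maximalIdeal R := fun i => hy ▸ Ideal.subset_span ⟨i, rfl⟩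
  have htm : t ∈ maximalIdeal R := ht ▸ Ideal.mul_mem_right β _ (hym j)
  have hqF : q (eval y F) = q (eval α F * t ^ e) := by
    have hqc (z : Fin n → R) : q (eval z F) = eval (fun i => q (z i)) (map q F) := by
      rw [eval_map]
      exact eval₂_comp q z F
    rw [hqc, funext hqy, eval_mul_of_isHomogeneous (hF.map q), map_mul, hqc, map_pow]
  have hqm : q (eval y F) ∈ Ideal.span {q t ^ (e + 1)} := by
    have h1 : (maximalIdeal R).map q ≤ Ideal.span {q t} := by
      rw [← hy, Ideal.map_span, Ideal.span_le]
      rintro _ ⟨_, ⟨i, rfl⟩, rfl⟩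
      rw [SetLike.mem_coe, hqy]
      exact Ideal.mul_mem_left _ _ (Ideal.mem_span_singleton_self _)
    have h2 := Ideal.mem_map_of_mem q hFy
    rw [Ideal.map_pow] at h2
    rw [← Ideal.span_singleton_pow]
    exact Ideal.pow_right_mono h1 _ h2
  obtain ⟨s', hs'⟩ := Ideal.mem_span_singleton'.1 hqm
  obtain ⟨s, rfl⟩ := Ideal.Quotient.mk_surjective s'
  -- Modulo `U`, `F(α) t ^ e` equals `F(y)`, a multiple `s t ^ (e + 1)`, and `F(α) - s t` is a unit.
  have htU : t ^ e ∈ U := by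
    have h1 : (eval α F - s * t) * t ^ e ∈ U := by
      rw [← Ideal.Quotient.eq_zero_iff_mem]
      change q _ = 0
      rw [sub_mul, map_sub, ← hqF, ← hs', map_mul, map_mul, map_pow, pow_succ']
      change q s * _ - _ = 0
      ring
    refine (Ideal.unit_mul_mem_iff_mem _ ?_).1 h1
    by_contra h
    have h3 : eval α F ∈ maximalIdeal R := by
      have := (maximalIdeal R).add_mem ((mem_maximalIdeal _).2 h)
        ((maximalIdeal R).mul_mem_left s htm)
      rwa [sub_add_cancel] at this
    exact h3 hunit
  have hUm : U ≤ maximalIdeal R := by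
    rw [hU, Ideal.span_le]
    rintro _ ⟨i, -, rfl⟩
    exact Ideal.sub_mem _ (hym i) (Ideal.mul_mem_left _ _ htm)
  have hmin : maximalIdeal R ∈ U.minimalPrimes := by
    refine ⟨⟨inferInstance, hUm⟩, fun P hP _ => ?_⟩
    rw [← hy, Ideal.span_le]
    rintro _ ⟨i, rfl⟩
    have := hP.1.mem_of_pow_mem _ (hP.2 htU)
    have := P.add_mem (hP.2 (huU i)) (P.mul_mem_left (α i) this)
    rwa [hu, sub_add_cancel] at this
  -- Krull's height theorem: the maximal ideal, of height `n`, is minimal over an ideal with `n - 1`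
  -- generators.
  have hh := Ideal.height_le_card_of_mem_minimalPrimes_span (Set.toFinite _) hmin
  have hc : (u '' {j}ᶜ).ncard ≤ n - 1 := by
    refine (Set.ncard_image_le (Set.toFinite _)).trans ?_
    rw [Set.ncard_compl, Set.ncard_singleton, Nat.card_eq_fintype_card, Fintype.card_fin]
  have hd : (maximalIdeal R).height = n := by
    have := (maximalIdeal_height_eq_ringKrullDim (R := R)).trans hdim
    exact_mod_cast this
  rw [hd] at hh
  have : n ≤ n - 1 := (by exact_mod_cast hh : n ≤ _).trans hc
  have := j.pos
  omega

end QuasiRegular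

/-! ### Weighted monomial filtrations. -/

section WeightedFiltration

variable {R : Type*} [CommRing R] {σ : Type*}

/-- The polynomials all of whose monomials have weight at least `m`. -/
def weightedOrderIdeal (R : Type*) [CommRing R] (w : σ → ℕ) (m : ℕ) : Ideal (MvPolynomial σ R) where
  carrier := {F | (m : ℕ∞) ≤ (F : MvPowerSeries σ R).weightedOrder w}
  zero_mem' := by simp
  add_mem' {F G} hF hG := by
    rw [Set.mem_ofPred_eq, coe_add]
    exact (le_min hF hG).trans (MvPowerSeries.min_weightedOrder_le_add w)
  smul_mem' c F hF := by
    rw [Set.mem_ofPred_eq, smul_eq_mul, coe_mul]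
    exact (le_add_of_nonneg_of_le zero_le hF).trans (MvPowerSeries.le_weightedOrder_mul w)

theorem mem_weightedOrderIdeal {w : σ → ℕ} {m : ℕ} {F : MvPolynomial σ R} :
    F ∈ weightedOrderIdeal R w m ↔ (m : ℕ∞) ≤ (F : MvPowerSeries σ R).weightedOrder w := Iff.rfl

theorem mem_weightedOrderIdeal_iff_coeff {w : σ → ℕ} {m : ℕ} {F : MvPolynomial σ R} :
    F ∈ weightedOrderIdeal R w m ↔ ∀ b, Finsupp.weight w b < m → coeff b F = 0 := by
  refine ⟨fun h b hb => ?_, fun h => MvPowerSeries.nat_le_weightedOrder w fun b hb => ?_⟩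
  · rw [← coeff_coe]
    exact MvPowerSeries.coeff_eq_zero_of_lt_weightedOrder w
      (lt_of_lt_of_le (by exact_mod_cast hb) h)
  · rw [coeff_coe]
    exact h b hb

theorem mul_mem_weightedOrderIdeal {w : σ → ℕ} {m n : ℕ} {F G : MvPolynomial σ R}
    (hF : F ∈ weightedOrderIdeal R w m) (hG : G ∈ weightedOrderIdeal R w n) :
    F * G ∈ weightedOrderIdeal R w (m + n) := by
  rw [mem_weightedOrderIdeal, coe_mul, Nat.cast_add]
  exact (add_le_add hF hG).trans (MvPowerSeries.le_weightedOrder_mul w)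

theorem weightedOrderIdeal_antitone (w : σ → ℕ) : Antitone (weightedOrderIdeal R w) :=
  fun _ _ h _ hF => mem_weightedOrderIdeal.2
    ((Nat.cast_le.2 h).trans (mem_weightedOrderIdeal.1 hF))

theorem monomial_mem_weightedOrderIdeal {w : σ → ℕ} {m : ℕ} {b : σ →₀ ℕ} (c : R)
    (h : m ≤ Finsupp.weight w b) : monomial b c ∈ weightedOrderIdeal R w m := by
  classical
  rw [mem_weightedOrderIdeal_iff_coeff]
  intro b' hb'
  rw [coeff_monomial, if_neg]
  rintro rfl
  omega

/-- The ideal generated by the monomials in `y` of weight at least `m`. -/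
def weightedFiltration (y : σ → R) (w : σ → ℕ) (m : ℕ) : Ideal R :=
  (weightedOrderIdeal R w m).map (eval y)

variable {y : σ → R} {w : σ → ℕ}

theorem mem_weightedFiltration {m : ℕ} {f : R} :
    f ∈ weightedFiltration y w m ↔ ∃ F ∈ weightedOrderIdeal R w m, eval y F = f :=
  Ideal.mem_map_iff_of_surjective _ fun r => ⟨C r, eval_C r⟩

theorem eval_mem_of_forall_monomial {I : Ideal R} {m : ℕ} {F : MvPolynomial σ R}
    (hF : F ∈ weightedOrderIdeal R w m)
    (h : ∀ b : σ →₀ ℕ, m ≤ Finsupp.weight w b → ∏ i ∈ b.support, y i ^ b i ∈ I) :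
    eval y F ∈ I := by
  rw [eval_eq]
  refine I.sum_mem fun b hb => I.mul_mem_left _ (h b ?_)
  by_contra! hlt
  exact mem_support_iff.1 hb (mem_weightedOrderIdeal_iff_coeff.1 hF b hlt)

theorem weightedFiltration_le {I : Ideal R} {m : ℕ}
    (h : ∀ b : σ →₀ ℕ, m ≤ Finsupp.weight w b → ∏ i ∈ b.support, y i ^ b i ∈ I) :
    weightedFiltration y w m ≤ I := fun f hf => by
  obtain ⟨F, hF, rfl⟩ := mem_weightedFiltration.1 hf
  exact eval_mem_of_forall_monomial hF h

theorem weightedFiltration_antitone : Antitone (weightedFiltration y w) :=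
  fun _ _ h => Ideal.map_mono (weightedOrderIdeal_antitone w h)

theorem weightedFiltration_zero : weightedFiltration y w 0 = ⊤ := by
  rw [Ideal.eq_top_iff_one, mem_weightedFiltration]
  exact ⟨1, by simp [mem_weightedOrderIdeal], map_one _⟩

theorem mul_mem_weightedFiltration {m n : ℕ} {f g : R} (hf : f ∈ weightedFiltration y w m)
    (hg : g ∈ weightedFiltration y w n) : f * g ∈ weightedFiltration y w (m + n) := by
  obtain ⟨F, hF, rfl⟩ := mem_weightedFiltration.1 hf
  obtain ⟨G, hG, rfl⟩ := mem_weightedFiltration.1 hg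
  exact mem_weightedFiltration.2 ⟨F * G, mul_mem_weightedOrderIdeal hF hG, map_mul _ _ _⟩

theorem self_mem_weightedFiltration (i : σ) : y i ∈ weightedFiltration y w (w i) :=
  mem_weightedFiltration.2 ⟨X i, monomial_mem_weightedOrderIdeal (b := Finsupp.single i 1) 1
    (by rw [Finsupp.weight_single, one_smul]), eval_X i⟩

theorem weight_one_eq_degree (b : σ →₀ ℕ) : Finsupp.weight (1 : σ → ℕ) b = b.degree := by
  rw [Finsupp.degree_eq_weight_one]
  rfl

theorem prod_pow_mem_pow_degree {I : Ideal R} (hyI : ∀ i, y i ∈ I) (b : σ →₀ ℕ) :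
    ∏ i ∈ b.support, y i ^ b i ∈ I ^ b.degree := by
  rw [Finsupp.degree_apply, ← Finset.prod_pow_eq_pow_sum]
  exact Ideal.prod_mem_prod fun i _ => Ideal.pow_mem_pow (hyI i) _

theorem eval_mem_pow_of_mem_weightedOrderIdeal_one {I : Ideal R} (hyI : ∀ i, y i ∈ I) {e : ℕ}
    {F : MvPolynomial σ R} (hF : F ∈ weightedOrderIdeal R (1 : σ → ℕ) e) : eval y F ∈ I ^ e :=
  eval_mem_of_forall_monomial hF fun b hb =>
    Ideal.pow_le_pow_right (by rwa [← weight_one_eq_degree]) (prod_pow_mem_pow_degree hyI b)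

/-- A form with coefficients in the ideal generated by `y` can be rewritten, without changing its
value at `y`, as a form of the next degree and of greater weighted order. -/
theorem exists_isHomogeneous_succ_of_coeff_mem (hw : ∀ i, 0 < w i) {F : MvPolynomial σ R} {e d : ℕ}
    (hF : F.IsHomogeneous e) (hFd : F ∈ weightedOrderIdeal R w d)
    (hc : ∀ b, coeff b F ∈ Ideal.span (Set.range y)) :
    ∃ G : MvPolynomial σ R, G.IsHomogeneous (e + 1) ∧ G ∈ weightedOrderIdeal R w (d + 1) ∧
      eval y G = eval y F := by
  choose p hp hpe using fun b => (Ideal.mem_span_iff_exists_isHomogeneous y _).1 (hc b)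
  -- Each coefficient is the value at `y` of a linear form, whose variables all have positive
  -- weight; substituting it raises both degree and weight.
  have hpw : ∀ b, p b ∈ weightedOrderIdeal R w 1 := fun b =>
    mem_weightedOrderIdeal_iff_coeff.2 fun c hlt => by
      by_contra h
      have hc1 : c.degree = 1 := by
        rw [← weight_one_eq_degree]
        exact hp b h
      obtain ⟨i, hi⟩ : ∃ i, c i ≠ 0 := by
        by_contra! h0
        rw [Finsupp.ext h0 (g := 0), map_zero] at hc1
        exact zero_ne_one hc1
      have := Finsupp.le_weight w (hw i).ne' c
      omega
  refine ⟨∑ b ∈ F.support, monomial b 1 * p b, IsHomogeneous.sum _ _ _ fun b hb => ?_,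
    Ideal.sum_mem _ fun b hb => mul_mem_weightedOrderIdeal
      (monomial_mem_weightedOrderIdeal 1 ?_) (hpw b), ?_⟩
  · refine (isHomogeneous_monomial _ ?_).mul (hp b)
    rw [← weight_one_eq_degree]
    exact hF (mem_support_iff.1 hb)
  · by_contra! hlt
    exact mem_support_iff.1 hb (mem_weightedOrderIdeal_iff_coeff.1 hFd b hlt)
  · rw [map_sum, eval_eq]
    refine Finset.sum_congr rfl fun b _ => ?_
    rw [map_mul, hpe, eval_monomial, one_mul, mul_comm, Finsupp.prod]

end WeightedFiltration

/-! ### The graded ring of a weighted filtration, and its valuation. -/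

section Local

variable {R : Type*} [CommRing R] [IsLocalRing R] {n : ℕ} {y : Fin n → R} {w : Fin n → ℕ}

/-- A polynomial relation between the parameters can be replaced by one of arbitrarily high degree
without changing, modulo the maximal ideal, its coefficients of least weight. -/
theorem exists_degree_le_of_eval_eq_zero [IsNoetherianRing R] [Infinite (ResidueField R)]
    (hdim : ringKrullDim R = n)
    (hy : Ideal.span (Set.range y) = maximalIdeal R) (hw : ∀ i, 0 < w i)
    {F : MvPolynomial (Fin n) R} {d : ℕ} (hF : F ∈ weightedOrderIdeal R w d)
    (hF0 : eval y F = 0) (e : ℕ) :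
    ∃ G ∈ weightedOrderIdeal R w d, G ∈ weightedOrderIdeal R (1 : Fin n → ℕ) e ∧ eval y G = 0 ∧
      ∀ b, Finsupp.weight w b = d → coeff b (F - G) ∈ maximalIdeal R := by
  induction e with
  | zero => exact ⟨F, hF, by simp [mem_weightedOrderIdeal], hF0, by simp⟩
  | succ e ih =>
    obtain ⟨G, hGd, hGe, hG0, hFG⟩ := ih
    have hym : ∀ i, y i ∈ maximalIdeal R := fun i => hy ▸ Ideal.subset_span ⟨i, rfl⟩
    set H := homogeneousComponent e G with hH
    have hHh : H.IsHomogeneous e := homogeneousComponent_isHomogeneous e G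
    have hcoeff : ∀ b, coeff b H = if b.degree = e then coeff b G else 0 :=
      fun b => coeff_homogeneousComponent e G b
    have hHd : H ∈ weightedOrderIdeal R w d := mem_weightedOrderIdeal_iff_coeff.2 fun b hb => by
      rw [hcoeff, mem_weightedOrderIdeal_iff_coeff.1 hGd b hb, ite_self]
    have hGH : G - H ∈ weightedOrderIdeal R (1 : Fin n → ℕ) (e + 1) :=
      mem_weightedOrderIdeal_iff_coeff.2 fun b hb => by
        rw [coeff_sub, hcoeff]
        rw [weight_one_eq_degree] at hb
        split_ifs with h
        · exact sub_self _
        · rw [sub_zero]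
          exact mem_weightedOrderIdeal_iff_coeff.1 hGe b (by
            rw [weight_one_eq_degree]
            omega)
    -- Since `G` vanishes at `y`, the value of its lowest form `H` is minus that of `G - H`, hence
    -- in the next power; quasi-regularity applies.
    have hHc : ∀ b, coeff b H ∈ maximalIdeal R := by
      refine coeff_mem_maximalIdeal_of_eval_mem_pow hdim hy hHh ?_
      have h1 := eval_mem_pow_of_mem_weightedOrderIdeal_one hym hGH
      rw [map_sub, hG0, zero_sub] at h1
      simpa using Ideal.neg_mem_iff _ |>.1 h1
    obtain ⟨H', hH'h, hH'd, hH'e⟩ :=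
      exists_isHomogeneous_succ_of_coeff_mem hw hHh hHd (fun b => hy ▸ hHc b)
    have hH'w : H' ∈ weightedOrderIdeal R (1 : Fin n → ℕ) (e + 1) :=
      mem_weightedOrderIdeal_iff_coeff.2 fun b hb => by
        by_contra h
        exact hb.ne (hH'h h)
    refine ⟨G - H + H', add_mem (sub_mem hGd hHd)
      (weightedOrderIdeal_antitone w (Nat.le_succ d) hH'd), add_mem hGH hH'w, ?_, fun b hb => ?_⟩
    · rw [map_add, map_sub, hG0, hH'e]
      ring
    -- `H'` has weight at least `d + 1`, so in weight `d` the replacement only removes coefficients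
    -- of `H`, which lie in the maximal ideal.
    · have h1 := mem_weightedOrderIdeal_iff_coeff.1 hH'd b (by omega)
      have h2 : coeff b (F - (G - H + H')) = coeff b (F - G) + coeff b H := by
        simp only [coeff_sub, coeff_add, h1]
        ring
      rw [h2]
      exact add_mem (hFG b hb) (hHc b)

/-- Weighted quasi-regularity. Subtracting a representative of weight at least `d + 1` yields an
exact relation with the same weight-`d` coefficients; pushing that relation beyond the degree of `b`
leaves no coefficient at `b`. -/
theorem coeff_mem_maximalIdeal_of_eval_mem_weightedFiltration [IsNoetherianRing R] [Infinite (ResidueField R)]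
    (hdim : ringKrullDim R = n)
    (hy : Ideal.span (Set.range y) = maximalIdeal R) (hw : ∀ i, 0 < w i)
    {F : MvPolynomial (Fin n) R} {d : ℕ} (hF : F ∈ weightedOrderIdeal R w d)
    (hF0 : eval y F ∈ weightedFiltration y w (d + 1)) {b : Fin n →₀ ℕ}
    (hb : Finsupp.weight w b = d) : coeff b F ∈ maximalIdeal R := by
  obtain ⟨E, hE, hEF⟩ := mem_weightedFiltration.1 hF0
  obtain ⟨G, -, hGe, -, hG⟩ := exists_degree_le_of_eval_eq_zero hdim hy hw
    (sub_mem hF (weightedOrderIdeal_antitone w (Nat.le_succ d) hE)) (by rw [map_sub, hEF, sub_self])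
    (b.degree + 1)
  have h1 := mem_weightedOrderIdeal_iff_coeff.1 hGe b
    (by rw [weight_one_eq_degree]; omega)
  have h2 := mem_weightedOrderIdeal_iff_coeff.1 hE b (by omega)
  simpa [coeff_sub, h1, h2] using hG b hb

/-- If every weight-`d` coefficient were in the maximal ideal, which is generated by elements of
positive weight, then each weight-`d` term would already lie one step deeper. -/
theorem weightedOrder_map_residue_eq (hy : Ideal.span (Set.range y) = maximalIdeal R)
    (hw : ∀ i, 0 < w i) {F : MvPolynomial (Fin n) R} {d : ℕ} (hF : F ∈ weightedOrderIdeal R w d)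
    (hF0 : eval y F ∉ weightedFiltration y w (d + 1)) :
    ((map (residue R) F : MvPolynomial (Fin n) (ResidueField R)) :
      MvPowerSeries (Fin n) (ResidueField R)).weightedOrder w = d := by
  rw [MvPowerSeries.weightedOrder_eq_nat]
  simp only [coeff_coe, coeff_map]
  refine ⟨?_, fun b hb => by rw [mem_weightedOrderIdeal_iff_coeff.1 hF b hb, map_zero]⟩
  by_contra! h
  apply hF0
  rw [eval_eq]
  refine Ideal.sum_mem _ fun b _ => ?_
  have hmon : ∏ i ∈ b.support, y i ^ b i ∈ weightedFiltration y w (Finsupp.weight w b) :=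
    mem_weightedFiltration.2 ⟨monomial b 1, monomial_mem_weightedOrderIdeal 1 le_rfl, by
      rw [eval_monomial, one_mul, Finsupp.prod]⟩
  rcases lt_trichotomy (Finsupp.weight w b) d with hlt | heq | hgt
  · rw [mem_weightedOrderIdeal_iff_coeff.1 hF b hlt, zero_mul]
    exact Ideal.zero_mem _
  · have hc : coeff b F ∈ weightedFiltration y w 1 := by
      have : coeff b F ∈ maximalIdeal R := by
        by_contra hc
        exact h b (fun h0 => hc ((residue_eq_zero_iff _).1 h0)) heq
      rw [← hy] at this
      refine Ideal.span_le.2 ?_ this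
      rintro _ ⟨i, rfl⟩
      exact weightedFiltration_antitone (hw i) (self_mem_weightedFiltration i)
    rw [add_comm, ← heq]
    exact mul_mem_weightedFiltration hc hmon
  · exact Ideal.mul_mem_left _ _ (weightedFiltration_antitone hgt hmon)

/-- The associated graded ring of the weighted filtration is a domain. -/
theorem mul_notMem_weightedFiltration [IsNoetherianRing R] [Infinite (ResidueField R)]
    (hdim : ringKrullDim R = n)
    (hy : Ideal.span (Set.range y) = maximalIdeal R) (hw : ∀ i, 0 < w i) {f g : R} {d e : ℕ}
    (hf : f ∈ weightedFiltration y w d) (hf' : f ∉ weightedFiltration y w (d + 1))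
    (hg : g ∈ weightedFiltration y w e) (hg' : g ∉ weightedFiltration y w (e + 1)) :
    f * g ∉ weightedFiltration y w (d + e + 1) := by
  obtain ⟨F, hF, rfl⟩ := mem_weightedFiltration.1 hf
  obtain ⟨G, hG, rfl⟩ := mem_weightedFiltration.1 hg
  intro h
  rw [← map_mul] at h
  have h1 := weightedOrder_map_residue_eq hy hw hF hf'
  have h2 := weightedOrder_map_residue_eq hy hw hG hg'
  -- Over the residue field there are no zero divisors, so weighted orders add: some weight-`(d +
  -- e)` coefficient of `F * G` is a unit.
  have h3 := MvPowerSeries.weightedOrder_mul w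
    ((map (residue R) F : MvPolynomial _ _) : MvPowerSeries (Fin n) (ResidueField R))
    (map (residue R) G : MvPolynomial _ _)
  rw [h1, h2, ← coe_mul, ← map_mul, ← Nat.cast_add, MvPowerSeries.weightedOrder_eq_nat] at h3
  obtain ⟨⟨b, hb, hbw⟩, -⟩ := h3
  rw [coeff_coe, coeff_map] at hb
  exact hb ((residue_eq_zero_iff _).2 (coeff_mem_maximalIdeal_of_eval_mem_weightedFiltration
    hdim hy hw (mul_mem_weightedOrderIdeal hF hG) h hbw))

/-- Used to identify the center of the associated valuation. -/
theorem weightedFiltration_one (hy : Ideal.span (Set.range y) = maximalIdeal R)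
    (hw : ∀ i, 0 < w i) : weightedFiltration y w 1 = maximalIdeal R := by
  have hym : ∀ i, y i ∈ maximalIdeal R := fun i => hy ▸ Ideal.subset_span ⟨i, rfl⟩
  refine le_antisymm (weightedFiltration_le fun b hb => ?_) ?_
  · have hb0 : b.degree ≠ 0 := by
      rw [Ne, Finsupp.degree_eq_zero_iff]
      rintro rfl
      simp at hb
    exact Ideal.pow_le_self hb0 (prod_pow_mem_pow_degree hym b)
  · rw [← hy, Ideal.span_le]
    rintro _ ⟨i, rfl⟩
    exact weightedFiltration_antitone (hw i) (self_mem_weightedFiltration i)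

/-- Weight is bounded by a constant times degree, so the filtration is cofinally finer than the
powers of the maximal ideal, and Krull's intersection theorem applies. -/
theorem iInf_weightedFiltration [IsNoetherianRing R] (hy : Ideal.span (Set.range y) = maximalIdeal R) :
    ⨅ m, weightedFiltration y w m = ⊥ := by
  have hym : ∀ i, y i ∈ maximalIdeal R := fun i => hy ▸ Ideal.subset_span ⟨i, rfl⟩
  rw [eq_bot_iff, ← Ideal.iInf_pow_eq_bot_of_isLocalRing _ (maximalIdeal.isMaximal R).ne_top]
  -- The sum bounds each single weight; the `+ 1` makes the factor positive, so that it can be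
  -- cancelled.
  refine le_iInf fun e => (iInf_le _ ((∑ i, w i + 1) * e)).trans (weightedFiltration_le fun b hb =>
    Ideal.pow_le_pow_right ?_ (prod_pow_mem_pow_degree hym b))
  have h1 : Finsupp.weight w b ≤ (∑ i, w i + 1) * b.degree := by
    rw [Finsupp.degree_eq_sum, Finset.mul_sum, Finsupp.weight_apply,
      Finsupp.sum_fintype _ _ (by simp)]
    refine Finset.sum_le_sum fun i _ => ?_
    rw [smul_eq_mul, mul_comm]
    exact Nat.mul_le_mul_right _
      ((Finset.single_le_sum (f := w) (fun _ _ => Nat.zero_le _) (Finset.mem_univ i)).trans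
        (Nat.le_succ _))
  exact Nat.le_of_mul_le_mul_left (hb.trans h1) (Nat.succ_pos _)

end Local

/-- A separated filtration by ideals whose associated graded ring is a domain comes from a
discrete valuation. -/
theorem exists_valuation_le_exp_iff {R : Type*} [CommRing R] [Nontrivial R] (J : ℕ → Ideal R)
    (hJ : Antitone J) (h0 : J 0 = ⊤) (hinf : ⨅ m, J m = ⊥)
    (hmul : ∀ {d e : ℕ} {f g : R}, f ∈ J d → g ∈ J e → f * g ∈ J (d + e))
    (hmul' : ∀ {d e : ℕ} {f g : R}, f ∈ J d → f ∉ J (d + 1) → g ∈ J e → g ∉ J (e + 1) →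
      f * g ∉ J (d + e + 1)) :
    ∃ v : Valuation R (WithZero (Multiplicative ℤ)), (∀ f, v f = 0 ↔ f = 0) ∧
      ∀ f (m : ℕ), v f ≤ WithZero.exp (-(m : ℤ)) ↔ f ∈ J m := by
  classical
  have hex : ∀ f : R, f ≠ 0 → ∃ d, f ∈ J d ∧ f ∉ J (d + 1) := by
    intro f hf
    by_contra! h
    apply hf
    rw [← Ideal.mem_bot, ← hinf, Ideal.mem_iInf]
    intro m
    induction m with
    | zero => rw [h0]; trivial
    | succ m ih => exact h m ih
  -- `o f` is the exact order of `f`; its value at `0` is arbitrary, so `0` is treated separately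
  -- below.
  choose! o ho ho' using hex
  have hle : ∀ f : R, f ≠ 0 → ∀ m, m ≤ o f ↔ f ∈ J m := fun f hf m =>
    ⟨fun h => hJ h (ho f hf), fun h => by
      by_contra! hlt
      exact ho' f hf (hJ hlt h)⟩
  have hne : ∀ f g : R, f ≠ 0 → g ≠ 0 → f * g ≠ 0 ∧ o (f * g) = o f + o g := by
    intro f g hf hg
    have h1 := hmul' (ho f hf) (ho' f hf) (ho g hg) (ho' g hg)
    have h2 := hmul (ho f hf) (ho g hg)
    have h3 : f * g ≠ 0 := fun h => h1 (h ▸ Ideal.zero_mem _)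
    refine ⟨h3, le_antisymm ?_ ((hle _ h3 _).2 h2)⟩
    by_contra! hlt
    exact h1 ((hle _ h3 _).1 hlt)
  let F : R → WithZero (Multiplicative ℤ) :=
    fun f => if f = 0 then 0 else WithZero.exp (-(o f : ℤ))
  have hF : ∀ f (m : ℕ), F f ≤ WithZero.exp (-(m : ℤ)) ↔ f ∈ J m := by
    intro f m
    by_cases hf : f = 0
    · simp [F, hf]
    · simp only [F, if_neg hf, WithZero.exp_le_exp, neg_le_neg_iff, Nat.cast_le]
      exact hle f hf m
  have hF0 : ∀ f, F f = 0 ↔ f = 0 := fun f => by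
    by_cases hf : f = 0 <;> simp [F, hf]
  have hFmul : ∀ f g, F (f * g) = F f * F g := by
    intro f g
    by_cases hf : f = 0
    · simp [F, hf]
    by_cases hg : g = 0
    · simp [F, hg]
    obtain ⟨h1, h2⟩ := hne f g hf hg
    simp only [F, if_neg hf, if_neg hg, if_neg h1, h2, ← WithZero.exp_add]
    congr 1
    push_cast
    ring
  refine ⟨{ toFun := F, map_zero' := (hF0 0).2 rfl, map_one' := ?_, map_mul' := hFmul,
            map_add_le_max' := ?_ }, hF0, hF⟩
  · have h1 : F 1 ≠ 0 := fun h => one_ne_zero ((hF0 1).1 h)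
    have h2 := hFmul 1 1
    rw [one_mul] at h2
    exact mul_left_cancel₀ h1 (by rw [← h2, mul_one])
  · intro f g
    wlog h : F f ≤ F g generalizing f g
    · rw [add_comm, max_comm]
      exact this g f (le_of_not_ge h)
    rw [max_eq_right h]
    by_cases hg : g = 0
    · have hf : f = 0 := by
        rw [← hF0, ← le_zero_iff, ← (hF0 g).2 hg]
        exact h
      simp [hf, hg]
    · have h1 : F g = WithZero.exp (-(o g : ℤ)) := if_neg hg
      rw [h1] at h ⊢
      rw [hF] at h ⊢
      exact add_mem h (ho g hg)

end WeightedBlowup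

namespace WeightedBlowup
open IsLocalRing

/-! ### Points of the Zariski–Riemann space and values of monomials. -/

section ZariskiRiemann

variable {k A : Type*} [Field k] [CommRing A] [IsDomain A] [Algebra k A]

theorem ZR.val_le_val_iff (z : ZR k A) (f g : A) :
    z.val f ≤ z.val g ↔ z.ring.valuation (algebraMap A (FractionRing A) g) ≤
      z.ring.valuation (algebraMap A (FractionRing A) f) := qVal_le_iff _ _ _

theorem ZR.val_pow (z : ZR k A) (f : A) (n : ℕ) : z.val (f ^ n) = n • z.val f := by
  induction n with
  | zero => rw [pow_zero, zero_nsmul, ZR.val, map_one, qVal_one]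
  | succ n ih => rw [pow_succ, ZR.val_mul, ih, succ_nsmul]

variable (k) in
/-- A valuation on `A`, nonnegative and with center `p`, defines a point of the Zariski-Riemann
space. -/
theorem exists_zr_val_le_val_iff {Γ₀ : Type*} [LinearOrderedCommGroupWithZero Γ₀]
    (v : Valuation A Γ₀) (p : PrimeSpectrum A) (h0 : ∀ f, v f = 0 ↔ f = 0) (h1 : ∀ f, v f ≤ 1)
    (hp : ∀ f, v f < 1 ↔ f ∈ p.asIdeal) :
    ∃ z : ZR k A, ∀ f g, z.val f ≤ z.val g ↔ v g ≤ v f := by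
  have hS : nonZeroDivisors A ≤ v.supp.primeCompl := fun s hs hs' =>
    nonZeroDivisors.ne_zero hs ((h0 s).1 hs')
  let V : Valuation (FractionRing A) Γ₀ := v.extendToLocalization hS (FractionRing A)
  have hV : ∀ f, V (algebraMap A (FractionRing A) f) = v f :=
    v.extendToLocalization_apply_map_apply hS _
  have hequiv := V.isEquiv_valuation_valuationSubring
  refine ⟨⟨V.valuationSubring, fun c => ?_, p, fun a s hs => ?_⟩, fun f g => ?_⟩
  · rw [IsScalarTower.algebraMap_apply k A (FractionRing A), Valuation.mem_valuationSubring_iff, hV]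
    exact h1 _
  · have hvs : v s = 1 := le_antisymm (h1 s) (not_lt.1 fun h => hs ((hp s).1 h))
    have hva : V (algebraMap A (FractionRing A) a / algebraMap A (FractionRing A) s) = v a := by
      rw [map_div₀, hV, hV, hvs, div_one]
    refine ⟨?_, ?_⟩
    · rw [Valuation.mem_valuationSubring_iff, hva]
      exact h1 a
    · rw [← hequiv.lt_one_iff_lt_one, hva]
      exact hp a
  · rw [ZR.val_le_val_iff, ← hequiv.le_iff_le, hV, hV]

theorem ValuativeQIdeal.mul_mem_smul_ideal (γ : ValuativeQIdeal k A) {m n : ℕ} {f g : A}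
    (hf : f ∈ (m • γ).ideal) (hg : g ∈ (n • γ).ideal) : f * g ∈ ((m + n) • γ).ideal := fun v => by
  rw [ZR.val_mul, smul_germ, add_smul, WithTop.coe_add]
  exact add_le_add (hf v) (hg v)

theorem ValuativeQIdeal.one_mem_zero_smul_ideal (γ : ValuativeQIdeal k A) :
    (1 : A) ∈ (0 • γ).ideal := fun v => by
  rw [smul_germ, zero_smul]
  exact v.val_nonneg 1

theorem ValuativeQIdeal.pow_mem_smul_ideal (γ : ValuativeQIdeal k A) {m : ℕ} {f : A}
    (hf : f ∈ (m • γ).ideal) (n : ℕ) : f ^ n ∈ ((m * n) • γ).ideal := by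
  induction n with
  | zero => exact pow_zero f ▸ γ.one_mem_zero_smul_ideal
  | succ n ih => exact pow_succ f n ▸ γ.mul_mem_smul_ideal ih hf

theorem ValuativeQIdeal.prod_mem_smul_ideal (γ : ValuativeQIdeal k A) {ι : Type*} (s : Finset ι)
    {m : ι → ℕ} {f : ι → A} (hf : ∀ i, f i ∈ (m i • γ).ideal) :
    ∏ i ∈ s, f i ∈ ((∑ i ∈ s, m i) • γ).ideal := by
  classical
  induction s using Finset.induction_on with
  | empty => exact γ.one_mem_zero_smul_ideal
  | insert i s hi ih =>
    rw [Finset.prod_insert hi, Finset.sum_insert hi]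
    exact γ.mul_mem_smul_ideal (hf i) ih

theorem ValuativeQIdeal.smul_ideal_antitone (γ : ValuativeQIdeal k A) :
    Antitone fun m : ℕ => (m • γ).ideal := fun _ _ h _ hf v =>
  (WithTop.coe_le_coe.2 (nsmul_le_nsmul_left (γ.germ_nonneg v) h)).trans (hf v)

variable {r : ℕ} {x : Fin r → A} (hx : IsRegularParameters x) {w : Fin r → ℕ} (hw : ∀ i, 0 < w i)

theorem exists_coe_eq_val_and_germ_eq_inf (z : ZR k A) :
    ∃ u : Fin r → QValGroup z.ring, (∀ i, z.val (x i) = u i) ∧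
      (((weightedCenter k x hx w hw).germ z : QValGroup z.ring) : WithTop (QValGroup z.ring)) =
        Finset.univ.inf fun i =>
          (((1 / (w i : ℚ)) • u i : QValGroup z.ring) : WithTop (QValGroup z.ring)) := by
  choose u hu using fun i => WithTop.ne_top_iff_exists.1 (z.val_ne_top (hx.ne_zero i))
  refine ⟨u, fun i => (hu i).symm, ?_⟩
  rw [weightedCenter, ValuativeQIdeal.coe_ofFunctions_germ]
  congr 1
  funext i
  rw [← hu i, WithTop.map_coe]

theorem nsmul_one_div_smul {z : ZR k A} {n : ℕ} (hn : 0 < n) (u : QValGroup z.ring) :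
    n • ((1 / (n : ℚ)) • u) = u := by
  rw [← Nat.cast_smul_eq_nsmul ℚ, smul_smul, mul_one_div_cancel (Nat.cast_ne_zero.2 hn.ne'),
    one_smul]

theorem mem_weight_smul_weightedCenter_ideal (i : Fin r) :
    x i ∈ (w i • weightedCenter k x hx w hw).ideal := fun z => by
  obtain ⟨u, hu, hγ⟩ := exists_coe_eq_val_and_germ_eq_inf hx hw z
  rw [hu, ValuativeQIdeal.smul_germ, WithTop.coe_le_coe, ← nsmul_one_div_smul (hw i) (u i)]
  refine nsmul_le_nsmul_right ?_ _
  rw [← WithTop.coe_le_coe, hγ]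
  exact Finset.inf_le (Finset.mem_univ i)

theorem prod_pow_mem_smul_weightedCenter_ideal {m : ℕ} {b : Fin r → ℕ}
    (hb : m ≤ ∑ i, w i * b i) :
    ∏ i, x i ^ b i ∈ (m • weightedCenter k x hx w hw).ideal :=
  ValuativeQIdeal.smul_ideal_antitone _ hb (ValuativeQIdeal.prod_mem_smul_ideal _ _ fun i =>
    ValuativeQIdeal.pow_mem_smul_ideal _ (mem_weight_smul_weightedCenter_ideal hx hw i) _)

/-- The minimum defining the germ is attained at some `i`; multiplying `v(f) ≥ (m / wᵢ) v(xᵢ)` by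
`wᵢ` removes the denominators, leaving a comparison inside the valuation ring. -/
theorem exists_val_pow_le_val_pow {m : ℕ} {f : A}
    (hf : f ∈ (m • weightedCenter k x hx w hw).ideal) (z : ZR k A) :
    ∃ i, z.val (x i ^ m) ≤ z.val (f ^ w i) := by
  obtain ⟨u, hu, hγ⟩ := exists_coe_eq_val_and_germ_eq_inf hx hw z
  have : Nonempty (Fin r) := ⟨⟨0, hx.pos⟩⟩
  obtain ⟨i, -, hi⟩ := Finset.exists_mem_eq_inf (Finset.univ : Finset (Fin r))
    Finset.univ_nonempty fun i =>
      (((1 / (w i : ℚ)) • u i : QValGroup z.ring) : WithTop (QValGroup z.ring))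
  have hγi := WithTop.coe_inj.1 (hγ.trans hi)
  refine ⟨i, ?_⟩
  have h := nsmul_le_nsmul_right (hf z) (w i)
  rw [ValuativeQIdeal.smul_germ, ← WithTop.coe_nsmul, nsmul_left_comm, hγi,
    nsmul_one_div_smul (hw i)] at h
  rwa [ZR.val_pow, ZR.val_pow, hu, ← WithTop.coe_nsmul]

end ZariskiRiemann

/-! ### Perturbed weights and Krull's intersection theorem. -/

section Local

variable {R : Type*} [CommRing R] [IsLocalRing R] {n r : ℕ}

/-- The weight function `1 + N wᵢ` on the parameters extending `x₁, …, x_r`, and `1` on the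
remaining ones. -/
def perturbedWeight (e : Fin r ↪ Fin n) (w : Fin r → ℕ) (N : ℕ) (j : Fin n) : ℕ :=
  1 + N * ∑ i, if e i = j then w i else 0

theorem perturbedWeight_apply (e : Fin r ↪ Fin n) (w : Fin r → ℕ) (N : ℕ) (i : Fin r) :
    perturbedWeight e w N (e i) = 1 + N * w i := by
  simp [perturbedWeight]

theorem weight_perturbedWeight (e : Fin r ↪ Fin n) (w : Fin r → ℕ) (N : ℕ) (b : Fin n →₀ ℕ) :
    Finsupp.weight (perturbedWeight e w N) b = b.degree + N * ∑ i, w i * b (e i) := by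
  rw [Finsupp.degree_eq_sum, Finsupp.weight_apply,
    Finsupp.sum_fintype _ _ fun i => zero_smul ℕ (perturbedWeight e w N i)]
  simp only [perturbedWeight, smul_eq_mul, mul_add, mul_one, Finset.sum_add_distrib]
  congr 1
  calc ∑ j, b j * (N * ∑ i, if e i = j then w i else 0)
      = N * ∑ j, ∑ i, if e i = j then w i * b j else 0 := by
        rw [Finset.mul_sum]
        refine Finset.sum_congr rfl fun j _ => ?_
        rw [mul_left_comm, Finset.mul_sum]
        simp only [mul_comm (b j), ite_mul, zero_mul]
    _ = N * ∑ i, w i * b (e i) := by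
        rw [Finset.sum_comm]
        simp only [Finset.sum_ite_eq, Finset.mem_univ, if_true]

/-- The perturbed weight of a monomial is its degree plus `N` times its `w`-weight. If this is at
least `N m` while the `w`-weight is at most `m - 1`, the degree is at least `N`. -/
theorem weightedFiltration_perturbedWeight_le {y : Fin n → R}
    (hy : Ideal.span (Set.range y) = maximalIdeal R) (e : Fin r ↪ Fin n) (w : Fin r → ℕ)
    (N m : ℕ) :
    weightedFiltration y (perturbedWeight e w N) (N * m) ≤
      Ideal.span {f : R | ∃ b : Fin r → ℕ, m ≤ ∑ i, w i * b i ∧ f = ∏ i, y (e i) ^ b i} ⊔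
        maximalIdeal R ^ N := by
  refine weightedFiltration_le fun b hb => ?_
  rw [weight_perturbedWeight] at hb
  by_cases h : m ≤ ∑ i, w i * b (e i)
  · refine Ideal.mem_sup_left (Ideal.mem_of_dvd _ ?_
      (Ideal.subset_span ⟨fun i => b (e i), h, rfl⟩))
    have h1 : ∏ i ∈ b.support, y i ^ b i = ∏ i, y i ^ b i :=
      Finset.prod_subset (Finset.subset_univ _) fun i _ hi => by
        rw [Finsupp.notMem_support_iff.1 hi, pow_zero]
    rw [h1, ← Finset.prod_map Finset.univ e fun j => y j ^ b j]
    exact Finset.prod_dvd_prod_of_subset _ _ _ (Finset.subset_univ _)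
  · refine Ideal.mem_sup_right (Ideal.pow_le_pow_right ?_ (prod_pow_mem_pow_degree
      (fun i => hy ▸ Ideal.subset_span ⟨i, rfl⟩) b))
    have h1 : N * (∑ i, w i * b (e i) + 1) ≤ N * m := Nat.mul_le_mul_left N (by omega)
    rw [mul_add, mul_one] at h1
    omega

/-- Krull's intersection theorem in the Noetherian local ring `R ⧸ I`. -/
theorem mem_of_forall_mem_sup_pow [IsNoetherianRing R] {I : Ideal R} {f : R}
    (h : ∀ N, f ∈ I ⊔ maximalIdeal R ^ N) : f ∈ I := by
  by_cases hI : I = ⊤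
  · rw [hI]
    trivial
  have : Nontrivial (R ⧸ I) := Ideal.Quotient.nontrivial_iff.2 hI
  have : IsLocalRing (R ⧸ I) := .of_surjective' _ (Ideal.Quotient.mk_surjective (I := I))
  rw [← Ideal.Quotient.eq_zero_iff_mem, ← Ideal.mem_bot,
    ← Ideal.iInf_pow_eq_bot_of_isLocalRing _ (maximalIdeal.isMaximal (R ⧸ I)).ne_top,
    Ideal.mem_iInf]
  intro N
  have h1 := Ideal.mem_map_of_mem (Ideal.Quotient.mk I) (h N)
  rw [Ideal.map_sup, Ideal.map_quotient_self, bot_sup_eq, Ideal.map_pow] at h1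
  refine Ideal.pow_right_mono ?_ N h1
  refine IsLocalRing.le_maximalIdeal fun htop => ?_
  have h2 := Ideal.comap_map_of_surjective (Ideal.Quotient.mk I)
    (Ideal.Quotient.mk_surjective) (maximalIdeal R)
  rw [htop, Ideal.comap_top, ← RingHom.ker_eq_comap_bot, Ideal.mk_ker,
    sup_eq_left.2 (IsLocalRing.le_maximalIdeal hI)] at h2
  exact (maximalIdeal.isMaximal R).ne_top h2.symm

end Local

/-! ### Local-to-global argument and the ideals `I_{mγ}`. -/

section Main

theorem mem_ideal_of_forall_isMaximal {A : Type*} [CommRing A] {I : Ideal A} {f : A}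
    (h : ∀ (P : Ideal A) [P.IsMaximal], algebraMap A (Localization.AtPrime P) f ∈
      I.map (algebraMap A (Localization.AtPrime P))) : f ∈ I := by
  -- If the ideal of denominators of `f` modulo `I` is proper, a maximal ideal containing it
  -- contradicts local membership there.
  let C : Ideal A := Submodule.colon I {f}
  have hC : ∀ a, a ∈ C ↔ a * f ∈ I := fun a => Submodule.mem_colon_singleton
  by_contra hf
  have hCtop : C ≠ ⊤ := fun hC' => hf (by
    have := (hC 1).1 (hC' ▸ Submodule.mem_top)
    rwa [one_mul] at this)
  obtain ⟨P, hP, hCP⟩ := Ideal.exists_le_maximal C hCtop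
  obtain ⟨s, hs, hsf⟩ := (IsLocalization.algebraMap_mem_map_algebraMap_iff P.primeCompl
    (Localization.AtPrime P) I f).1 (h P)
  exact hs (hCP ((hC s).2 hsf))

variable {k A : Type*} [Field k] [CharZero k] [CommRing A] [IsDomain A] [Algebra k A]

-- This is where characteristic zero enters: it supplies the infinite residue field needed for
-- quasi-regularity.
variable (k) in
theorem infinite_residueField (R : Type*) [CommRing R] [IsLocalRing R] [Algebra k R] :
    Infinite (ResidueField R) := by
  have : CharZero (ResidueField R) :=
    charZero_of_injective_algebraMap (algebraMap k (ResidueField R)).injective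
  infer_instance

/-- The valuation of `A` given by a weighted filtration at a point with a regular system of
parameters. -/
theorem exists_zr_val_le_iff_mem_weightedFiltration [IsNoetherianRing A] (p : PrimeSpectrum A)
    {n : ℕ} {y : Fin n → Localization.AtPrime p.asIdeal} (hy : IsRegularSystemOfParameters _ y)
    {W : Fin n → ℕ} (hW : ∀ i, 0 < W i) :
    ∃ (z : ZR k A) (v : Valuation A (WithZero (Multiplicative ℤ))),
      (∀ f g, z.val f ≤ z.val g ↔ v g ≤ v f) ∧
      ∀ f (m : ℕ), v f ≤ WithZero.exp (-(m : ℤ)) ↔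
        algebraMap A (Localization.AtPrime p.asIdeal) f ∈ weightedFiltration y W m := by
  have := infinite_residueField k (Localization.AtPrime p.asIdeal)
  obtain ⟨v, hv0, hv⟩ := exists_valuation_le_exp_iff (weightedFiltration y W)
    weightedFiltration_antitone weightedFiltration_zero (iInf_weightedFiltration hy.span_eq)
    mul_mem_weightedFiltration (mul_notMem_weightedFiltration hy.ringKrullDim_eq hy.span_eq hW)
  have hinj : Function.Injective (algebraMap A (Localization.AtPrime p.asIdeal)) :=
    IsLocalization.injective _ p.asIdeal.primeCompl_le_nonZeroDivisors
  have h1 : ∀ f, v f ≤ 1 := fun f => by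
    have := (hv f 0).2 (by rw [weightedFiltration_zero]; trivial)
    simpa using this
  obtain ⟨z, hz⟩ := exists_zr_val_le_val_iff k (v.comap (algebraMap A _)) p
    (fun f => (hv0 _).trans (map_eq_zero_iff _ hinj)) (fun f => h1 _) fun f => by
      -- By discreteness, positive order means order at least `1`, that is, membership in the first
      -- filtration step, which is the maximal ideal.
      have h2 : ∀ g, v g < 1 ↔ v g ≤ WithZero.exp (-((1 : ℕ) : ℤ)) := fun g => by
        simpa using WithZero.lt_mul_exp_iff_le (x := v g) (y := WithZero.exp (-1))
          WithZero.exp_ne_zero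
      rw [Valuation.comap_apply, h2, hv, weightedFiltration_one hy.span_eq hW]
      exact IsLocalization.AtPrime.to_map_mem_maximal_iff _ p.asIdeal f
  exact ⟨z, v.comap (algebraMap A _), hz, fun f m => hv _ m⟩

variable {r : ℕ} {x : Fin r → A} (hx : IsRegularParameters x) {w : Fin r → ℕ} (hw : ∀ i, 0 < w i)

theorem algebraMap_mem_of_mem_smul_weightedCenter_ideal [IsNoetherianRing A] {m : ℕ} {f : A}
    (hf : f ∈ (m • weightedCenter k x hx w hw).ideal) (p : PrimeSpectrum A)
    (hp : p ∈ PrimeSpectrum.zeroLocus (Set.range x)) :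
    algebraMap A (Localization.AtPrime p.asIdeal) f ∈
      (Ideal.span {f : A | ∃ b : Fin r → ℕ, m ≤ ∑ i, w i * b i ∧ f = ∏ i, x i ^ b i}).map
        (algebraMap A (Localization.AtPrime p.asIdeal)) := by
  obtain ⟨n, y, e, hy, hye⟩ := hx.extends_at p hp
  refine mem_of_forall_mem_sup_pow fun N => ?_
  have hle : Ideal.span {f | ∃ b : Fin r → ℕ, m ≤ ∑ i, w i * b i ∧ f = ∏ i, y (e i) ^ b i} ≤
      (Ideal.span {f : A | ∃ b : Fin r → ℕ, m ≤ ∑ i, w i * b i ∧ f = ∏ i, x i ^ b i}).map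
        (algebraMap A (Localization.AtPrime p.asIdeal)) := by
    rw [Ideal.span_le]
    rintro _ ⟨b, hb, rfl⟩
    simp_rw [hye, ← map_pow, ← map_prod]
    exact Ideal.mem_map_of_mem _ (Ideal.subset_span ⟨b, hb, rfl⟩)
  refine sup_le_sup_right hle _ (weightedFiltration_perturbedWeight_le hy.span_eq e w N m ?_)
  obtain ⟨z, v, hz, hv⟩ := exists_zr_val_le_iff_mem_weightedFiltration (k := k) p hy
    (W := perturbedWeight e w N) fun i => by
      rw [perturbedWeight]
      omega
  rw [← hv]
  obtain ⟨i, hi⟩ := exists_val_pow_le_val_pow hx hw hf z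
  rw [hz, map_pow, map_pow] at hi
  -- The parameter has weight `1 + N wᵢ`; the extra `1` can be dropped.
  have hxi : v (x i) ≤ WithZero.exp (-((N * w i : ℕ) : ℤ)) := by
    rw [hv, ← hye]
    refine weightedFiltration_antitone ?_ (self_mem_weightedFiltration (e i))
    rw [perturbedWeight_apply]
    omega
  -- Extract a `wᵢ`-th root from `v(f) ^ wᵢ ≤ v(xᵢ) ^ m ≤ exp (-(N wᵢ m))`.
  refine le_of_pow_le_pow_left₀ (hw i).ne' zero_le (hi.trans ((pow_le_pow_left₀ zero_le hxi m).trans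
    (le_of_eq ?_)))
  rw [← WithZero.exp_nsmul, ← WithZero.exp_nsmul]
  congr 1
  simp only [nsmul_eq_mul]
  push_cast
  ring

theorem smul_weightedCenter_ideal [IsNoetherianRing A] (m : ℕ) :
    (m • weightedCenter k x hx w hw).ideal =
      Ideal.span {f : A | ∃ b : Fin r → ℕ, m ≤ ∑ i, w i * b i ∧ f = ∏ i, x i ^ b i} := by
  refine le_antisymm (fun f hf => mem_ideal_of_forall_isMaximal fun P _ => ?_)
    (Ideal.span_le.2 ?_)
  · by_cases hP : Set.range x ⊆ P
    · exact algebraMap_mem_of_mem_smul_weightedCenter_ideal hx hw hf ⟨P, inferInstance⟩ hP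
    · obtain ⟨_, ⟨i, rfl⟩, hi⟩ := Set.not_subset.1 hP
      rw [IsLocalization.algebraMap_mem_map_algebraMap_iff P.primeCompl]
      -- Away from `V(x)`, the denominator `xᵢ ^ m` works: it is itself a generator, as its weight
      -- `wᵢ m` is at least `m`.
      refine ⟨x i ^ m, P.primeCompl.pow_mem hi m, Ideal.mul_mem_right _ _
        (Ideal.subset_span ⟨Pi.single i m, ?_, ?_⟩)⟩
      · simpa [Pi.single_apply] using Nat.le_mul_of_pos_left m (hw i)
      · rw [Finset.prod_eq_single i (fun j _ hj => by simp [hj]) (by simp)]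
        simp
  · rintro _ ⟨b, hb, rfl⟩
    exact prod_pow_mem_smul_weightedCenter_ideal hx hw hb

/-! ### Generators of the Rees algebra. -/

open Polynomial in
/-- A monomial of weight at least `m`, placed in degree `m`, is a product of the elements
`xᵢ Tʲ` with `j ≤ wᵢ`. -/
theorem C_prod_pow_mul_X_pow_mem_adjoin {R : Type*} [CommRing R] {ι : Type*} (x : ι → R)
    (w : ι → ℕ) (s : Finset ι) (b : ι → ℕ) {m : ℕ} (hm : m ≤ ∑ i ∈ s, w i * b i) :
    C (∏ i ∈ s, x i ^ b i) * X ^ m ∈ Algebra.adjoin R {p : R[X] | ∃ (i : ι) (j : ℕ),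
      1 ≤ j ∧ j ≤ w i ∧ p = C (x i) * X ^ j} := by
  classical
  set S := Algebra.adjoin R {p : R[X] | ∃ (i : ι) (j : ℕ), 1 ≤ j ∧ j ≤ w i ∧ p = C (x i) * X ^ j}
  have hx : ∀ i j, j ≤ w i → C (x i) * X ^ j ∈ S := fun i j hj => by
    rcases Nat.eq_zero_or_pos j with rfl | h
    · rw [pow_zero, mul_one]
      exact S.algebraMap_mem (x i)
    · exact Algebra.subset_adjoin ⟨i, j, h, hj, rfl⟩
  have hpow : ∀ i n j, j ≤ w i * n → C (x i ^ n) * X ^ j ∈ S := fun i n => by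
    induction n with
    | zero =>
      intro j hj
      rw [Nat.le_zero.1 hj, pow_zero, pow_zero, map_one, mul_one]
      exact S.one_mem
    | succ n ih =>
      intro j hj
      -- Greedy splitting: one factor `xᵢ` absorbs as much of `T ^ j` as its weight allows, and the
      -- remaining `n` factors carry the rest.
      have h1 := S.mul_mem (ih (j - min j (w i)) (by rw [mul_add, mul_one] at hj; omega))
        (hx i (min j (w i)) (min_le_right _ _))
      convert h1 using 1
      rw [pow_succ, C_mul, mul_mul_mul_comm, ← pow_add, Nat.sub_add_cancel (min_le_left _ _)]
  induction s using Finset.induction_on generalizing m with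
  | empty =>
    rw [Finset.sum_empty, Nat.le_zero] at hm
    rw [hm, Finset.prod_empty, map_one, pow_zero, mul_one]
    exact S.one_mem
  | insert i s hi ih =>
    rw [Finset.sum_insert hi] at hm
    -- The same greedy splitting, now between the power of `xᵢ` and the other variables.
    have h1 := S.mul_mem (hpow i (b i) (min m (w i * b i)) (min_le_right _ _))
      (ih (m := m - min m (w i * b i)) (by omega))
    convert h1 using 1
    rw [Finset.prod_insert hi, C_mul, mul_mul_mul_comm, ← pow_add,
      Nat.add_sub_cancel' (min_le_left _ _)]

open Polynomial in
theorem weightedCenter_reesAlgebra [IsNoetherianRing A] :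
    (weightedCenter k x hx w hw).reesAlgebra =
      Algebra.adjoin A {p : A[X] | ∃ (i : Fin r) (j : ℕ), 1 ≤ j ∧ j ≤ w i ∧
        p = C (x i) * X ^ j} := by
  refine le_antisymm (fun p hp => ?_) (Algebra.adjoin_le ?_)
  · rw [← p.sum_monomial_eq]
    refine Subalgebra.sum_mem _ fun m _ => ?_
    have h := hp m
    rw [smul_weightedCenter_ideal] at h
    simp only [← C_mul_X_pow_eq_monomial]
    generalize p.coeff m = c at h
    induction h using Submodule.span_induction with
    | mem c hc =>
      obtain ⟨b, hb, rfl⟩ := hc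
      exact C_prod_pow_mul_X_pow_mem_adjoin x w Finset.univ b hb
    | zero =>
      rw [map_zero, zero_mul]
      exact Subalgebra.zero_mem _
    | add c d _ _ hc hd =>
      rw [map_add, add_mul]
      exact Subalgebra.add_mem _ hc hd
    | smul a c _ hc =>
      rw [smul_eq_mul, C_mul, mul_assoc]
      exact Subalgebra.mul_mem _ (Subalgebra.algebraMap_mem _ a) hc
  · rintro _ ⟨i, j, -, hj, rfl⟩ m
    rw [coeff_C_mul_X_pow]
    split_ifs with h
    · exact ValuativeQIdeal.smul_ideal_antitone _ (h.le.trans hj)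
        (mem_weight_smul_weightedCenter_ideal hx hw i)
    · exact Ideal.zero_mem _

end Main

end WeightedBlowup

end

theorem mainTheorem1 {k A : Type*} [Field k] [CharZero k] [CommRing A] [IsDomain A] [Algebra k A]
    [Algebra.Smooth k A] {r : ℕ} (x : Fin r → A) (hx : WeightedBlowup.IsRegularParameters x)
    (w : Fin r → ℕ) (hw : ∀ i, 0 < w i) :
    (∀ m : ℕ, (m • WeightedBlowup.weightedCenter k x hx w hw).ideal =
      Ideal.span {f : A | ∃ b : Fin r → ℕ, m ≤ ∑ i, w i * b i ∧ f = ∏ i, x i ^ b i}) ∧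
    (WeightedBlowup.weightedCenter k x hx w hw).reesAlgebra =
      Algebra.adjoin A {p : Polynomial A | ∃ (i : Fin r) (j : ℕ), 1 ≤ j ∧ j ≤ w i ∧
        p = Polynomial.C (x i) * Polynomial.X ^ j} := by
  have : IsNoetherianRing A := Algebra.FiniteType.isNoetherianRing k A
  exact ⟨WeightedBlowup.smul_weightedCenter_ideal hx hw,
    WeightedBlowup.weightedCenter_reesAlgebra hx hw⟩
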